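/- Let $\mathscr I$ be a smooth $3$-dimensional manifold with a smooth Lorentzian metric $\ell_{ab}$ of signature $(-,+,+)$ and Levi-Civita connection $D_a$. The curvature convention is $D_cD_du^a-D_dD_cu^a=r^a{}_{bcd}u^b$. Let $r_{bd}=r^a{}_{bad}$ be the Ricci tensor, $r=\ell^{ab}r_{ab}$ the Ricci scalar, $l_{ab}=r_{ab}-\tfrac14 r\,\ell_{ab}$ the Schouten tensor, and $\Delta=\ell^{ab}D_aD_b$ the D'Alembertian. Indices are raised and lowered with $\ell_{ab}$, and $\mathcal L_\zeta$ denotes the Lie derivative along $\zeta^a=\ell^{ab}\zeta_b$. If a smooth covector field $\zeta_a$ and a smooth function $\eta$ on $\mathscr I$ satisfy $$D_a\zeta_b+D_b\zeta_a=2\eta\,\ell_{ab}\qquad\text{and}\qquad \mathcal L_\zeta l_{ab}+D_aD_b\eta=0$$ on $\mathscr I$, then on $\mathscr I$ $$\Delta\zeta_a=-r_a{}^b\zeta_b-D_a\eta\qquad\text{and}\qquad \Delta\eta=-\tfrac12\,\eta\, r-\tfrac14\,\zeta^bD_br .$$ -/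

import Mathlib

open scoped Manifold ContDiff

noncomputable section

/-- The coordinate space `ℝ³`. -/
abbrev Coord : Type := EuclideanSpace ℝ (Fin 3)

/-! ### Calculus of tensor components on a coordinate domain

The components of a metric, a scalar, a covector and a covariant 2-tensor are functions of the
coordinates `x : Coord`. All expressions are used only at points of an open coordinate domain. -/

namespace Comp

/-- The partial derivative `∂_i f`. -/
def pd (i : Fin 3) (f : Coord → ℝ) (x : Coord) : ℝ :=
  fderiv ℝ f x (EuclideanSpace.single i 1)

/-- The components `g^{ij}` of the inverse metric. -/
def inv (g : Coord → Matrix (Fin 3) (Fin 3) ℝ) (x : Coord) (i j : Fin 3) : ℝ :=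
  (g x)⁻¹ i j

/-- The Christoffel symbols
`Γ^k_{ij} = ½ g^{km} (∂_i g_{jm} + ∂_j g_{im} - ∂_m g_{ij})` of the Levi-Civita connection. -/
def christoffel (g : Coord → Matrix (Fin 3) (Fin 3) ℝ) (k i j : Fin 3) (x : Coord) : ℝ :=
  (1 / 2) * ∑ m, inv g x k m *
    (pd i (fun y => g y j m) x + pd j (fun y => g y i m) x - pd m (fun y => g y i j) x)

/-- The Riemann tensor `r^a_{bcd}`, with the convention
`D_c D_d u^a - D_d D_c u^a = r^a_{bcd} u^b`. -/
def riemann (g : Coord → Matrix (Fin 3) (Fin 3) ℝ) (a b c d : Fin 3) (x : Coord) : ℝ :=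
  pd c (christoffel g a d b) x - pd d (christoffel g a c b) x +
    ∑ e, (christoffel g a c e x * christoffel g e d b x -
      christoffel g a d e x * christoffel g e c b x)

/-- The Ricci tensor `r_{bd} = r^a_{bad}`. -/
def ricci (g : Coord → Matrix (Fin 3) (Fin 3) ℝ) (b d : Fin 3) (x : Coord) : ℝ :=
  ∑ a, riemann g a b a d x

/-- The Ricci scalar `r = g^{bd} r_{bd}`. -/
def scalar (g : Coord → Matrix (Fin 3) (Fin 3) ℝ) (x : Coord) : ℝ :=
  ∑ b, ∑ d, inv g x b d * ricci g b d x

/-- The three-dimensional Schouten tensor `l_{ab} = r_{ab} - ¼ r g_{ab}`. -/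
def schouten (g : Coord → Matrix (Fin 3) (Fin 3) ℝ) (a b : Fin 3) (x : Coord) : ℝ :=
  ricci g a b x - (1 / 4) * scalar g x * g x a b

/-- Raising the index of a covector: `w^a = g^{ab} w_b`. -/
def raise (g : Coord → Matrix (Fin 3) (Fin 3) ℝ) (w : Fin 3 → Coord → ℝ)
    (a : Fin 3) (x : Coord) : ℝ :=
  ∑ b, inv g x a b * w b x

/-- The covariant derivative of a covector: `D_a w_b = ∂_a w_b - Γ^c_{ab} w_c`. -/
def covD₁ (g : Coord → Matrix (Fin 3) (Fin 3) ℝ) (w : Fin 3 → Coord → ℝ)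
    (a b : Fin 3) (x : Coord) : ℝ :=
  pd a (w b) x - ∑ c, christoffel g c a b x * w c x

/-- The covariant derivative of a covariant 2-tensor:
`D_c T_{ab} = ∂_c T_{ab} - Γ^d_{ca} T_{db} - Γ^d_{cb} T_{ad}`. -/
def covD₂ (g : Coord → Matrix (Fin 3) (Fin 3) ℝ) (T : Fin 3 → Fin 3 → Coord → ℝ)
    (c a b : Fin 3) (x : Coord) : ℝ :=
  pd c (T a b) x - ∑ d, (christoffel g d c a x * T d b x + christoffel g d c b x * T a d x)

/-- The second covariant derivative of a scalar: `D_a D_b f`. -/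
def hess (g : Coord → Matrix (Fin 3) (Fin 3) ℝ) (f : Coord → ℝ)
    (a b : Fin 3) (x : Coord) : ℝ :=
  covD₁ g (fun c => pd c f) a b x

/-- The D'Alembertian of a scalar: `Δ f = g^{ab} D_a D_b f`. -/
def box₀ (g : Coord → Matrix (Fin 3) (Fin 3) ℝ) (f : Coord → ℝ) (x : Coord) : ℝ :=
  ∑ a, ∑ b, inv g x a b * hess g f a b x

/-- The D'Alembertian of a covector: `Δ w_c = g^{ab} D_a D_b w_c`. -/
def box₁ (g : Coord → Matrix (Fin 3) (Fin 3) ℝ) (w : Fin 3 → Coord → ℝ)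
    (c : Fin 3) (x : Coord) : ℝ :=
  ∑ a, ∑ b, inv g x a b * covD₂ g (covD₁ g w) a b c x

/-- The Lie derivative of a covariant 2-tensor along a vector field `v`:
`(𝓛_v T)_{ab} = v^c ∂_c T_{ab} + T_{cb} ∂_a v^c + T_{ac} ∂_b v^c`. -/
def lieD (v : Fin 3 → Coord → ℝ) (T : Fin 3 → Fin 3 → Coord → ℝ)
    (a b : Fin 3) (x : Coord) : ℝ :=
  ∑ c, (v c x * pd c (T a b) x + T c b x * pd a (v c) x + T a c x * pd b (v c) x)

end Comp

/-! ### Fields on a three-dimensional manifold -/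

/-- A smooth Lorentzian metric of signature `(-,+,+)` on a smooth 3-manifold. -/
structure LorentzianMetric (M : Type*) [TopologicalSpace M] [ChartedSpace Coord M]
    [IsManifold (𝓡 3) ∞ M] where
  /-- The bilinear form on each tangent space. -/
  form (p : M) : TangentSpace (𝓡 3) p →L[ℝ] TangentSpace (𝓡 3) p →L[ℝ] ℝ
  /-- Each tangent space has an orthonormal basis, with a single timelike vector; in particular
  the form is symmetric and nondegenerate. -/
  lorentzian (p : M) : ∃ b : Module.Basis (Fin 3) ℝ (TangentSpace (𝓡 3) p),
    ∀ i j, form p (b i) (b j) = Matrix.diagonal ![-1, 1, 1] i j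
  contMDiff : ContMDiff (𝓡 3) ((𝓡 3).prod 𝓘(ℝ, Coord →L[ℝ] Coord →L[ℝ] ℝ)) ∞
    (fun p => Bundle.TotalSpace.mk' (Coord →L[ℝ] Coord →L[ℝ] ℝ)
      (E := fun p : M => TangentSpace (𝓡 3) p →L[ℝ] TangentSpace (𝓡 3) p →L[ℝ] ℝ) p (form p))

/-- A smooth covector field on a smooth 3-manifold. -/
structure CovectorField (M : Type*) [TopologicalSpace M] [ChartedSpace Coord M]
    [IsManifold (𝓡 3) ∞ M] where
  /-- The linear form on each tangent space. -/
  form (p : M) : TangentSpace (𝓡 3) p →L[ℝ] ℝ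
  contMDiff : ContMDiff (𝓡 3) ((𝓡 3).prod 𝓘(ℝ, Coord →L[ℝ] ℝ)) ∞
    (fun p => Bundle.TotalSpace.mk' (Coord →L[ℝ] ℝ)
      (E := fun p : M => TangentSpace (𝓡 3) p →L[ℝ] ℝ) p (form p))

/-- The coordinate vector field `∂_i` of the chart `e`, at the point with coordinates `x`. -/
def coordVec {M : Type*} [TopologicalSpace M] [ChartedSpace Coord M]
    (e : OpenPartialHomeomorph M Coord) (i : Fin 3) (x : Coord) :
    TangentSpace (𝓡 3) (e.symm x) :=
  mfderiv (𝓡 3) (𝓡 3) e.symm x (EuclideanSpace.single i 1 : Coord)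

/-- The components `ℓ_{ij} = ℓ(∂_i, ∂_j)` of a metric in the chart `e`. -/
def LorentzianMetric.comp {M : Type*} [TopologicalSpace M] [ChartedSpace Coord M]
    [IsManifold (𝓡 3) ∞ M] (ℓ : LorentzianMetric M) (e : OpenPartialHomeomorph M Coord)
    (x : Coord) : Matrix (Fin 3) (Fin 3) ℝ :=
  Matrix.of fun i j => ℓ.form (e.symm x) (coordVec e i x) (coordVec e j x)

/-- The components `ζ_i = ζ(∂_i)` of a covector field in the chart `e`. -/
def CovectorField.comp {M : Type*} [TopologicalSpace M] [ChartedSpace Coord M]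
    [IsManifold (𝓡 3) ∞ M] (ζ : CovectorField M) (e : OpenPartialHomeomorph M Coord)
    (i : Fin 3) (x : Coord) : ℝ :=
  ζ.form (e.symm x) (coordVec e i x)

end

/-!
In a chart the statement concerns a smooth, symmetric, invertible matrix of functions `g` on an open
set, a covector `w`, and a scalar `η`. Both identities come from taking traces.

For the first one, differentiate the conformal Killing equation
`D_a w_b + D_b w_a = 2 η g_{ab}`. Metric compatibility gives
`D_c D_a w_b + D_c D_b w_a = 2 D_c η g_{ab}`, and the trace over `a, b` of this is
`g^{ab} D_c D_a w_b = 3 D_c η`. On the other hand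
`D_a D_b w_c = 2 D_a η g_{bc} - D_a D_c w_b`, and exchanging `D_a` and `D_c` by the Ricci identity
and tracing over `a, b` gives `Δ w_c = 2 D_c η - 3 D_c η - r_{ce} w^e`. The curvature facts behind
this are `Comp.IsMetricOn.ricci_identity`, the antisymmetry of the lowered Riemann tensor in its
first pair of indices (`Comp.IsMetricOn.riemann_antisymm`, which is the commutation of second
derivatives of the metric), and the symmetry of the Ricci tensor, which follows from the first
Bianchi identity.

For the second one, the conformal Killing equation says `𝓛_v g = 2 η g` for `v^a = w^a`, so that
`𝓛_v g^{ab} = -2 η g^{ab}` and `g^{ab} 𝓛_v l_{ab} = v(g^{ab} l_{ab}) + 2 η g^{ab} l_{ab}`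
(`Comp.IsMetricOn.sum_inv_lieD`). In dimension three the trace of the Schouten tensor is `r / 4`,
and the left-hand side is `-Δ η` by hypothesis.

The passage from the manifold to a chart (`LorentzianMetric.isMetricOn_comp` and
`CovectorField.contDiffOn_comp`) uses that the coordinate vector fields of a chart of the maximal
atlas are smooth and linearly independent.
-/

/-! ### Partial derivatives -/

namespace Comp

variable {U : Set Coord} {f h : Coord → ℝ} {x : Coord}

lemma pd_add (i : Fin 3) (hf : DifferentiableAt ℝ f x) (hh : DifferentiableAt ℝ h x) :
    pd i (fun y => f y + h y) x = pd i f x + pd i h x := by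
  simp [pd, fderiv_fun_add hf hh]

lemma pd_sub (i : Fin 3) (hf : DifferentiableAt ℝ f x) (hh : DifferentiableAt ℝ h x) :
    pd i (fun y => f y - h y) x = pd i f x - pd i h x := by
  simp [pd, fderiv_fun_sub hf hh]

lemma pd_mul (i : Fin 3) (hf : DifferentiableAt ℝ f x) (hh : DifferentiableAt ℝ h x) :
    pd i (fun y => f y * h y) x = pd i f x * h x + f x * pd i h x := by
  simp [pd, fderiv_fun_mul hf hh]; ring

lemma pd_sum {ι : Type*} (s : Finset ι) (i : Fin 3) {F : ι → Coord → ℝ}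
    (hF : ∀ k ∈ s, DifferentiableAt ℝ (F k) x) :
    pd i (fun y => ∑ k ∈ s, F k y) x = ∑ k ∈ s, pd i (F k) x := by
  simp [pd, fderiv_fun_sum hF]

lemma pd_const_mul (i : Fin 3) (c : ℝ) (hf : DifferentiableAt ℝ f x) :
    pd i (fun y => c * f y) x = c * pd i f x := by
  simp [pd, fderiv_const_mul hf]

lemma pd_congr (hU : IsOpen U) (hx : x ∈ U) (i : Fin 3) (hfh : ∀ y ∈ U, f y = h y) :
    pd i f x = pd i h x := by
  simp only [pd]
  rw [Filter.EventuallyEq.fderiv_eq (Filter.eventually_of_mem (hU.mem_nhds hx) hfh)]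

lemma differentiableAt_of_contDiffOn (hU : IsOpen U) (hf : ContDiffOn ℝ ∞ f U) (hx : x ∈ U) :
    DifferentiableAt ℝ f x :=
  (hf.contDiffAt (hU.mem_nhds hx)).differentiableAt (by simp)

lemma contDiffOn_pd (hU : IsOpen U) (hf : ContDiffOn ℝ ∞ f U) (i : Fin 3) :
    ContDiffOn ℝ ∞ (pd i f) U :=
  (hf.fderiv_of_isOpen hU (m := ∞) (by simp)).clm_apply contDiffOn_const

lemma pd_sum_mul {ι : Type*} [Fintype ι] (i : Fin 3) {F H : ι → Coord → ℝ}
    (hF : ∀ k, DifferentiableAt ℝ (F k) x) (hH : ∀ k, DifferentiableAt ℝ (H k) x) :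
    pd i (fun y => ∑ k, F k y * H k y) x =
      ∑ k, (pd i (F k) x * H k x + F k x * pd i (H k) x) := by
  rw [pd_sum (F := fun k y => F k y * H k y) _ _ fun k _ => (hF k).fun_mul (hH k)]
  exact Finset.sum_congr rfl fun k _ => pd_mul i (hF k) (hH k)

/-- Partial derivatives commute. -/
lemma pd_pd_comm (hU : IsOpen U) (hf : ContDiffOn ℝ ∞ f U) (hx : x ∈ U) (i j : Fin 3) :
    pd i (pd j f) x = pd j (pd i f) x := by
  have hfx := hf.contDiffAt (hU.mem_nhds hx)
  have hd : DifferentiableAt ℝ (fderiv ℝ f) x :=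
    (hfx.fderiv_right (m := 1) (by norm_cast)).differentiableAt (by simp)
  have key (k l : Fin 3) : pd k (pd l f) x =
      fderiv ℝ (fderiv ℝ f) x (EuclideanSpace.single k 1) (EuclideanSpace.single l 1) := by
    simp only [pd]
    change fderiv ℝ (fun y => fderiv ℝ f y (EuclideanSpace.single l 1)) x _ = _
    rw [fderiv_clm_apply hd (differentiableAt_const _)]
    simp
  rw [key, key]
  exact (hfx.isSymmSndFDerivAt (by simp; norm_cast)).eq _ _

/-! ### The Levi-Civita connection and its curvature -/

/-- A metric given by its components on an open subset `U` of the coordinate space: smooth,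
symmetric and nondegenerate there. -/
structure IsMetricOn (U : Set Coord) (g : Coord → Matrix (Fin 3) (Fin 3) ℝ) : Prop where
  isOpen : IsOpen U
  contDiffOn (i j : Fin 3) : ContDiffOn ℝ ∞ (fun x => g x i j) U
  symm {x : Coord} (hx : x ∈ U) (i j : Fin 3) : g x i j = g x j i
  det_ne_zero {x : Coord} (hx : x ∈ U) : (g x).det ≠ 0

namespace IsMetricOn

variable {g : Coord → Matrix (Fin 3) (Fin 3) ℝ} (hg : IsMetricOn U g)
include hg

lemma sum_inv_mul (hx : x ∈ U) (i j : Fin 3) :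
    ∑ k, inv g x i k * g x k j = if i = j then 1 else 0 := by
  have := congrFun₂ (Matrix.nonsing_inv_mul (g x) (hg.det_ne_zero hx).isUnit) i j
  simpa [Matrix.mul_apply, Matrix.one_apply, inv] using this

lemma sum_mul_inv (hx : x ∈ U) (i j : Fin 3) :
    ∑ k, g x i k * inv g x k j = if i = j then 1 else 0 := by
  have := congrFun₂ (Matrix.mul_nonsing_inv (g x) (hg.det_ne_zero hx).isUnit) i j
  simpa [Matrix.mul_apply, Matrix.one_apply, inv] using this

lemma inv_symm (hx : x ∈ U) (i j : Fin 3) : inv g x i j = inv g x j i := by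
  have h : (g x).transpose = g x := Matrix.ext fun i j => hg.symm hx j i
  have h' : ((g x)⁻¹).transpose = (g x)⁻¹ := by rw [Matrix.transpose_nonsing_inv, h]
  exact congrFun₂ h' j i

lemma contDiffOn_inv (i j : Fin 3) : ContDiffOn ℝ ∞ (fun x => inv g x i j) U := by
  have hdet (F : Coord → Matrix (Fin 3) (Fin 3) ℝ)
      (hF : ∀ i j, ContDiffOn ℝ ∞ (fun x => F x i j) U) :
      ContDiffOn ℝ ∞ (fun x => (F x).det) U := by
    simp only [Matrix.det_apply']
    exact ContDiffOn.sum fun σ _ => contDiffOn_const.mul (contDiffOn_prod fun k _ => hF _ _)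
  have hadj : ContDiffOn ℝ ∞ (fun x => (g x).adjugate i j) U := by
    simp only [Matrix.adjugate_apply]
    refine hdet _ fun k l => ?_
    simp only [Matrix.updateRow_apply]
    split_ifs
    · exact contDiffOn_const
    · exact hg.contDiffOn k l
  refine (((hdet g hg.contDiffOn).inv fun x hx => hg.det_ne_zero hx).mul hadj).congr ?_
  intro x _
  simp [inv, Matrix.inv_def]

lemma contDiffOn_christoffel (k i j : Fin 3) : ContDiffOn ℝ ∞ (christoffel g k i j) U := by
  unfold christoffel
  refine contDiffOn_const.mul (ContDiffOn.sum fun m _ => (hg.contDiffOn_inv k m).mul ?_)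
  exact ((contDiffOn_pd hg.isOpen (hg.contDiffOn _ _) _).add
    (contDiffOn_pd hg.isOpen (hg.contDiffOn _ _) _)).sub
    (contDiffOn_pd hg.isOpen (hg.contDiffOn _ _) _)

lemma contDiffOn_ricci (b d : Fin 3) : ContDiffOn ℝ ∞ (ricci g b d) U := by
  have hΓ := hg.contDiffOn_christoffel
  unfold ricci riemann
  refine ContDiffOn.sum fun a _ => ((contDiffOn_pd hg.isOpen (hΓ _ _ _) _).sub
    (contDiffOn_pd hg.isOpen (hΓ _ _ _) _)).add (ContDiffOn.sum fun e _ => ?_)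
  exact ((hΓ _ _ _).mul (hΓ _ _ _)).sub ((hΓ _ _ _).mul (hΓ _ _ _))

lemma contDiffOn_schouten (a b : Fin 3) : ContDiffOn ℝ ∞ (schouten g a b) U := by
  unfold schouten scalar
  refine (hg.contDiffOn_ricci a b).sub ((contDiffOn_const.mul ?_).mul (hg.contDiffOn a b))
  exact ContDiffOn.sum fun b _ => ContDiffOn.sum fun d _ =>
    (hg.contDiffOn_inv b d).mul (hg.contDiffOn_ricci b d)

lemma contDiffOn_raise {w : Fin 3 → Coord → ℝ} (hw : ∀ i, ContDiffOn ℝ ∞ (w i) U) (a : Fin 3) :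
    ContDiffOn ℝ ∞ (raise g w a) U :=
  ContDiffOn.sum fun b _ => (hg.contDiffOn_inv a b).mul (hw b)

lemma contDiffOn_covD₁ {w : Fin 3 → Coord → ℝ} (hw : ∀ i, ContDiffOn ℝ ∞ (w i) U) (a b : Fin 3) :
    ContDiffOn ℝ ∞ (covD₁ g w a b) U :=
  (contDiffOn_pd hg.isOpen (hw b) a).sub
    (ContDiffOn.sum fun c _ => (hg.contDiffOn_christoffel c a b).mul (hw c))

lemma lower_raise {w : Fin 3 → Coord → ℝ} (hx : x ∈ U) (b : Fin 3) :
    ∑ c, g x b c * raise g w c x = w b x := by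
  simp only [raise, Finset.mul_sum]
  rw [Finset.sum_comm]
  simp only [← mul_assoc, ← Finset.sum_mul, hg.sum_mul_inv hx]
  simp

lemma christoffel_symm (hx : x ∈ U) (k i j : Fin 3) :
    christoffel g k i j x = christoffel g k j i x := by
  simp only [christoffel]
  congr 1
  refine Finset.sum_congr rfl fun m _ => ?_
  rw [pd_congr hg.isOpen hx m fun y hy => hg.symm hy i j]
  ring

/-- Lowering an index of the Christoffel symbols gives those of the first kind. -/
lemma lower_christoffel (hx : x ∈ U) (l i j : Fin 3) :
    ∑ k, g x l k * christoffel g k i j x = (1 / 2) * (pd i (fun y => g y j l) x +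
      pd j (fun y => g y i l) x - pd l (fun y => g y i j) x) := by
  have h (k : Fin 3) : g x l k * christoffel g k i j x = ∑ m, (g x l k * inv g x k m) *
      ((1 / 2) * (pd i (fun y => g y j m) x + pd j (fun y => g y i m) x -
        pd m (fun y => g y i j) x)) := by
    simp only [christoffel, Finset.mul_sum]
    exact Finset.sum_congr rfl fun m _ => by ring
  simp only [h]
  rw [Finset.sum_comm]
  simp only [← Finset.sum_mul, hg.sum_mul_inv hx]
  simp

/-- Metric compatibility: `∂_c g_{ab} = Γ^e_{ca} g_{eb} + Γ^e_{cb} g_{ae}`. -/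
lemma pd_metric (hx : x ∈ U) (c a b : Fin 3) :
    pd c (fun y => g y a b) x =
      ∑ e, (christoffel g e c a x * g x e b + christoffel g e c b x * g x a e) := by
  have h₁ := hg.lower_christoffel hx b c a
  have h₂ := hg.lower_christoffel hx a c b
  have h (e : Fin 3) : christoffel g e c a x * g x e b + christoffel g e c b x * g x a e =
      g x b e * christoffel g e c a x + g x a e * christoffel g e c b x := by
    rw [hg.symm hx e b]; ring
  simp only [h, Finset.sum_add_distrib, h₁, h₂]
  rw [pd_congr hg.isOpen hx c fun y hy => hg.symm hy b a,
    pd_congr hg.isOpen hx b fun y hy => hg.symm hy c a]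
  ring

/-- The derivative of the inverse metric. -/
lemma pd_inv (hx : x ∈ U) (c a b : Fin 3) :
    pd c (fun y => inv g y a b) x =
      -∑ i, ∑ j, inv g x a i * pd c (fun y => g y i j) x * inv g x j b := by
  have hd (i j : Fin 3) := differentiableAt_of_contDiffOn hg.isOpen (hg.contDiffOn i j) hx
  have hi (i j : Fin 3) := differentiableAt_of_contDiffOn hg.isOpen (hg.contDiffOn_inv i j) hx
  -- differentiate `g^{ai} g_{ij} = δ^a_j`
  have h (j : Fin 3) : ∑ i, pd c (fun y => inv g y a i) x * g x i j =
      -∑ i, inv g x a i * pd c (fun y => g y i j) x := by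
    have h₀ : pd c (fun y => ∑ i, inv g y a i * g y i j) x = 0 := by
      rw [pd_congr hg.isOpen hx c fun y hy => hg.sum_inv_mul hy a j]
      simp [pd]
    rw [pd_sum_mul (F := fun i y => inv g y a i) (H := fun i y => g y i j) c
      (fun i => hi a i) (fun i => hd i j), Finset.sum_add_distrib] at h₀
    linarith
  calc pd c (fun y => inv g y a b) x
      = ∑ i, pd c (fun y => inv g y a i) x * ∑ j, g x i j * inv g x j b := by
        simp [hg.sum_mul_inv hx]
    _ = ∑ j, (∑ i, pd c (fun y => inv g y a i) x * g x i j) * inv g x j b := by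
        simp only [Finset.mul_sum, Finset.sum_mul]
        rw [Finset.sum_comm]
        simp only [mul_assoc]
    _ = _ := by
        simp only [h, neg_mul, Finset.sum_neg_distrib, Finset.sum_mul]
        rw [Finset.sum_comm]

/-- The Ricci identity for a covector field:
`D_a D_c w_b - D_c D_a w_b = -r^e_{bac} w_e`. -/
lemma ricci_identity {w : Fin 3 → Coord → ℝ} (hw : ∀ i, ContDiffOn ℝ ∞ (w i) U) (hx : x ∈ U)
    (a b c : Fin 3) :
    covD₂ g (covD₁ g w) a c b x - covD₂ g (covD₁ g w) c a b x =
      -∑ e, riemann g e b a c x * w e x := by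
  have hw' (i : Fin 3) := differentiableAt_of_contDiffOn hg.isOpen (hw i) hx
  have hΓ (k i j : Fin 3) :=
    differentiableAt_of_contDiffOn hg.isOpen (hg.contDiffOn_christoffel k i j) hx
  have hpd (a c : Fin 3) : pd a (covD₁ g w c b) x = pd a (pd c (w b)) x -
      ∑ e, (pd a (christoffel g e c b) x * w e x + christoffel g e c b x * pd a (w e) x) := by
    rw [← pd_sum_mul a (fun e => hΓ e c b) hw']
    exact pd_sub a (differentiableAt_of_contDiffOn hg.isOpen
      (contDiffOn_pd hg.isOpen (hw b) c) hx)
      (DifferentiableAt.fun_sum fun e _ => (hΓ e c b).fun_mul (hw' e))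
  simp only [covD₂, hpd]
  rw [pd_pd_comm hg.isOpen (hw b) hx a c]
  simp only [covD₁, riemann, Fin.sum_univ_three, hg.christoffel_symm hx _ c a]
  ring

/-- The lowered Riemann tensor is antisymmetric in its first two indices: this is the commutation of
the second partial derivatives of the metric, each written out by metric compatibility. -/
lemma riemann_antisymm (hx : x ∈ U) (a b c d : Fin 3) :
    ∑ e, (riemann g e a c d x * g x e b + riemann g e b c d x * g x a e) = 0 := by
  have hd (i j : Fin 3) := differentiableAt_of_contDiffOn hg.isOpen (hg.contDiffOn i j) hx
  have hΓ (k i j : Fin 3) :=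
    differentiableAt_of_contDiffOn hg.isOpen (hg.contDiffOn_christoffel k i j) hx
  have hpd (c d : Fin 3) : pd c (pd d fun y => g y a b) x =
      ∑ e, (pd c (christoffel g e d a) x * g x e b +
        christoffel g e d a x * pd c (fun y => g y e b) x) +
      ∑ e, (pd c (christoffel g e d b) x * g x a e +
        christoffel g e d b x * pd c (fun y => g y a e) x) := by
    rw [pd_congr hg.isOpen hx c fun y hy => hg.pd_metric hy d a b,
      ← pd_sum_mul (H := fun e y => g y e b) c (fun e => hΓ e d a) fun e => hd e b,
      ← pd_sum_mul (H := fun e y => g y a e) c (fun e => hΓ e d b) fun e => hd a e,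
      ← pd_add c (DifferentiableAt.fun_sum fun e _ => (hΓ e d a).fun_mul (hd e b))
        (DifferentiableAt.fun_sum fun e _ => (hΓ e d b).fun_mul (hd a e))]
    simp only [Finset.sum_add_distrib]
  -- the second partial derivatives of the metric commute
  have h := pd_pd_comm hg.isOpen (hg.contDiffOn a b) hx c d
  simp only [hpd, hg.pd_metric hx, Fin.sum_univ_three] at h
  simp only [riemann, Fin.sum_univ_three]
  linear_combination h

/-- The first Bianchi identity. -/
lemma riemann_cyclic (hx : x ∈ U) (a b c d : Fin 3) :
    riemann g a b c d x + riemann g a c d b x + riemann g a d b c x = 0 := by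
  have h (i k j l : Fin 3) : pd l (christoffel g k i j) x = pd l (christoffel g k j i) x :=
    pd_congr hg.isOpen hx l fun y hy => hg.christoffel_symm hy k i j
  simp only [riemann, Fin.sum_univ_three, h d a b, h c a b, h d a c,
    hg.christoffel_symm hx _ d b, hg.christoffel_symm hx _ c b, hg.christoffel_symm hx _ d c]
  ring

/-- The trace `r^a_{acd}` vanishes. -/
lemma sum_riemann (hx : x ∈ U) (c d : Fin 3) : ∑ a, riemann g a a c d x = 0 := by
  have h : ∑ a, ∑ b, inv g x a b *
      ∑ e, (riemann g e a c d x * g x e b + riemann g e b c d x * g x a e) = 0 := by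
    simp [hg.riemann_antisymm hx]
  have h₁ : ∑ a, ∑ b, inv g x a b * ∑ e, riemann g e a c d x * g x e b =
      ∑ a, riemann g a a c d x := by
    refine Finset.sum_congr rfl fun a _ => ?_
    simp only [Finset.mul_sum]
    rw [Finset.sum_comm]
    have (e b : Fin 3) : inv g x a b * (riemann g e a c d x * g x e b) =
        riemann g e a c d x * (inv g x a b * g x b e) := by rw [hg.symm hx e b]; ring
    simp only [this, ← Finset.mul_sum, hg.sum_inv_mul hx]
    simp
  have h₂ : ∑ a, ∑ b, inv g x a b * ∑ e, riemann g e b c d x * g x a e =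
      ∑ a, riemann g a a c d x := by
    rw [Finset.sum_comm]
    refine Finset.sum_congr rfl fun b _ => ?_
    simp only [Finset.mul_sum]
    rw [Finset.sum_comm]
    have (e a : Fin 3) : inv g x a b * (riemann g e b c d x * g x a e) =
        riemann g e b c d x * (inv g x b a * g x a e) := by rw [hg.inv_symm hx a b]; ring
    simp only [this, ← Finset.mul_sum, hg.sum_inv_mul hx]
    simp
  simp only [Finset.sum_add_distrib, mul_add] at h
  linarith

lemma ricci_symm (hx : x ∈ U) (b d : Fin 3) : ricci g b d x = ricci g d b x := by
  have h := hg.sum_riemann hx d b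
  have h' : ∑ a, (riemann g a b a d x + riemann g a a d b x + riemann g a d b a x) = 0 :=
    Finset.sum_eq_zero fun a _ => hg.riemann_cyclic hx a b a d
  have h'' (a : Fin 3) : riemann g a d b a x = -riemann g a d a b x := by
    simp only [riemann, Fin.sum_univ_three]; ring
  simp only [Finset.sum_add_distrib, h, h'', Finset.sum_neg_distrib] at h'
  simp only [ricci]
  linarith

/-- The curvature term of the traced Ricci identity: `g^{ab} r^e_{bac} w_e = -r_{ce} w^e`, by the
antisymmetry of the lowered Riemann tensor in its first two indices. -/
lemma sum_inv_riemann {w : Fin 3 → Coord → ℝ} (hx : x ∈ U) (c : Fin 3) :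
    ∑ a, ∑ b, inv g x a b * ∑ e, riemann g e b a c x * w e x =
      -∑ e, ricci g c e x * raise g w e x := by
  have h (a b : Fin 3) : ∑ e, riemann g e b a c x * w e x =
      -∑ f, (∑ e, riemann g e f a c x * g x b e) * raise g w f x := by
    simp only [← hg.lower_raise (w := w) hx, Finset.mul_sum]
    rw [Finset.sum_comm, ← Finset.sum_neg_distrib]
    refine Finset.sum_congr rfl fun f _ => ?_
    have := hg.riemann_antisymm hx b f a c
    simp only [← mul_assoc, ← Finset.sum_mul]
    rw [Finset.sum_add_distrib] at this
    linear_combination raise g w f x * this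
  have h' (a f : Fin 3) : ∑ b, inv g x a b * ∑ e, riemann g e f a c x * g x b e =
      riemann g a f a c x := by
    simp only [Finset.mul_sum]
    rw [Finset.sum_comm]
    simp only [mul_left_comm (inv g x a _), ← Finset.mul_sum, hg.sum_inv_mul hx]
    simp
  simp only [h, mul_neg, Finset.sum_neg_distrib, hg.ricci_symm hx c]
  congr 1
  calc ∑ a, ∑ b, inv g x a b *
        ∑ f, (∑ e, riemann g e f a c x * g x b e) * raise g w f x
      = ∑ a, ∑ f, (∑ b, inv g x a b * ∑ e, riemann g e f a c x * g x b e) *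
          raise g w f x := by
        refine Finset.sum_congr rfl fun a _ => ?_
        simp only [Finset.mul_sum _ _ (inv g x a _), Finset.sum_mul _ _ (raise g w _ x)]
        rw [Finset.sum_comm]
        simp only [mul_assoc]
    _ = _ := by
        simp only [h', ricci]
        rw [Finset.sum_comm]
        simp only [Finset.sum_mul]

end IsMetricOn
end Comp

/-! ### Conformal Killing covectors -/

namespace Comp.IsMetricOn

variable {U : Set Coord} {x : Coord} {g : Coord → Matrix (Fin 3) (Fin 3) ℝ} (hg : IsMetricOn U g)
  {w : Fin 3 → Coord → ℝ} {η : Coord → ℝ}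
include hg

/-- The covariant derivative of the conformal Killing equation. -/
lemma covD₂_add_of_conformalKilling (hw : ∀ i, ContDiffOn ℝ ∞ (w i) U) (hη : ContDiffOn ℝ ∞ η U)
    (hK : ∀ y ∈ U, ∀ a b, covD₁ g w a b y + covD₁ g w b a y = 2 * η y * g y a b) (hx : x ∈ U)
    (c a b : Fin 3) :
    covD₂ g (covD₁ g w) c a b x + covD₂ g (covD₁ g w) c b a x = 2 * pd c η x * g x a b := by
  have hT (a b : Fin 3) := differentiableAt_of_contDiffOn hg.isOpen (hg.contDiffOn_covD₁ hw a b) hx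
  have hη' := differentiableAt_of_contDiffOn hg.isOpen hη hx
  have hg' := differentiableAt_of_contDiffOn hg.isOpen (hg.contDiffOn a b) hx
  have h : pd c (covD₁ g w a b) x + pd c (covD₁ g w b a) x =
      2 * pd c η x * g x a b + 2 * η x * pd c (fun y => g y a b) x := by
    rw [← pd_add c (hT a b) (hT b a), pd_congr hg.isOpen hx c fun y hy => hK y hy a b,
      pd_mul c (hη'.const_mul 2) hg', pd_const_mul c 2 hη']
  -- `∂_c g_{ab}` cancels against the Christoffel terms acting on the Killing equation at `x`
  rw [hg.pd_metric hx] at h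
  have hK' := hK x hx
  simp only [covD₂, Fin.sum_univ_three] at h ⊢
  linear_combination h - christoffel g 0 c a x * hK' 0 b - christoffel g 1 c a x * hK' 1 b -
    christoffel g 2 c a x * hK' 2 b - christoffel g 0 c b x * hK' a 0 -
    christoffel g 1 c b x * hK' a 1 - christoffel g 2 c b x * hK' a 2

/-- A conformal Killing covector satisfies `Δ w_c = -r_c^e w_e - D_c η`. -/
theorem box₁_of_conformalKilling (hw : ∀ i, ContDiffOn ℝ ∞ (w i) U) (hη : ContDiffOn ℝ ∞ η U)
    (hK : ∀ y ∈ U, ∀ a b, covD₁ g w a b y + covD₁ g w b a y = 2 * η y * g y a b) (hx : x ∈ U)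
    (c : Fin 3) :
    box₁ g w c x = -(∑ e, ricci g c e x * raise g w e x) - pd c η x := by
  have hD := hg.covD₂_add_of_conformalKilling hw hη hK hx
  have hR := hg.ricci_identity hw hx
  -- `D_a D_b w_c = 2 D_a η g_{bc} - D_c D_a w_b + r^e_{bac} w_e`
  have h (a b : Fin 3) : covD₂ g (covD₁ g w) a b c x =
      2 * pd a η x * g x b c - covD₂ g (covD₁ g w) c a b x +
        ∑ e, riemann g e b a c x * w e x := by
    linear_combination hD a b c - hR a b c
  have h₁ : ∑ a, ∑ b, inv g x a b * (2 * pd a η x * g x b c) = 2 * pd c η x := by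
    have (a b : Fin 3) : inv g x a b * (2 * pd a η x * g x b c) =
      2 * pd a η x * (inv g x a b * g x b c) := by ring
    simp only [this, ← Finset.mul_sum, hg.sum_inv_mul hx]
    simp
  -- the trace of the differentiated Killing equation, with `g^{ab} g_{ab} = 3`
  have h₂ : ∑ a, ∑ b, inv g x a b * covD₂ g (covD₁ g w) c a b x = 3 * pd c η x := by
    have hs : ∑ a, ∑ b, inv g x a b * covD₂ g (covD₁ g w) c b a x =
        ∑ a, ∑ b, inv g x a b * covD₂ g (covD₁ g w) c a b x := by
      rw [Finset.sum_comm]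
      simp only [hg.inv_symm hx]
    have ht : ∑ a, ∑ b, inv g x a b * (2 * pd c η x * g x a b) = 6 * pd c η x := by
      have (a b : Fin 3) : inv g x a b * (2 * pd c η x * g x a b) =
        2 * pd c η x * (inv g x a b * g x b a) := by rw [hg.symm hx a b]; ring
      simp only [this, ← Finset.mul_sum, hg.sum_inv_mul hx]
      simp
      ring
    simp only [← hD, mul_add, Finset.sum_add_distrib] at ht
    linarith
  simp only [box₁, h, mul_add, mul_sub, Finset.sum_add_distrib, Finset.sum_sub_distrib]
  rw [h₁, h₂, hg.sum_inv_riemann hx]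
  ring

/-- `𝓛_v g_{ab} = D_a w_b + D_b w_a` for `v^a = g^{ab} w_b`, so that the conformal Killing equation
says `𝓛_v g = 2 η g`. -/
lemma lieD_metric (hw : ∀ i, ContDiffOn ℝ ∞ (w i) U) (hx : x ∈ U) (a b : Fin 3) :
    lieD (raise g w) (fun a b y => g y a b) a b x = covD₁ g w a b x + covD₁ g w b a x := by
  have hd (i j : Fin 3) := differentiableAt_of_contDiffOn hg.isOpen (hg.contDiffOn i j) hx
  have hv (i : Fin 3) :=
    differentiableAt_of_contDiffOn hg.isOpen (hg.contDiffOn_raise hw i) hx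
  have h (a b : Fin 3) : pd a (w b) x =
      ∑ c, (pd a (fun y => g y b c) x * raise g w c x + g x b c * pd a (raise g w c) x) := by
    rw [← pd_sum_mul (F := fun c y => g y b c) a (fun c => hd b c) hv]
    exact pd_congr hg.isOpen hx a fun y hy => (hg.lower_raise hy b).symm
  have hs (i j k : Fin 3) : pd k (fun y => g y i j) x = pd k (fun y => g y j i) x :=
    pd_congr hg.isOpen hx k fun y hy => hg.symm hy i j
  have hΓ (a b : Fin 3) : ∑ k, christoffel g k a b x * w k x =
      ∑ l, (1 / 2) * (pd a (fun y => g y b l) x + pd b (fun y => g y a l) x -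
        pd l (fun y => g y a b) x) * raise g w l x := by
    simp only [← hg.lower_christoffel hx, ← hg.lower_raise (w := w) hx, Finset.mul_sum,
      Finset.sum_mul]
    rw [Finset.sum_comm]
    refine Finset.sum_congr rfl fun l _ => Finset.sum_congr rfl fun k _ => ?_
    rw [hg.symm hx l k]; ring
  simp only [covD₁, hΓ, h, lieD, ← Finset.sum_add_distrib, ← Finset.sum_sub_distrib]
  refine Finset.sum_congr rfl fun c _ => ?_
  rw [hs b a c, hg.symm hx c b]
  ring

/-- The trace of the Schouten tensor is `r / 4`. -/
lemma sum_inv_schouten (hx : x ∈ U) :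
    ∑ a, ∑ b, inv g x a b * schouten g a b x = (1 / 4) * scalar g x := by
  have h : ∑ a, ∑ b, inv g x a b * ((1 / 4) * scalar g x * g x a b) = (3 / 4) * scalar g x := by
    have (a b : Fin 3) : inv g x a b * ((1 / 4) * scalar g x * g x a b) =
        (1 / 4) * scalar g x * (inv g x a b * g x b a) := by rw [hg.symm hx a b]; ring
    simp only [this, ← Finset.mul_sum, hg.sum_inv_mul hx]
    simp
    ring
  simp only [schouten, mul_sub, Finset.sum_sub_distrib, h]
  rw [← scalar]
  ring

/-- The Lie derivative of the inverse metric along a vector field `v` with `𝓛_v g = 2 s g` at a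
point is `-2 s g^{ab}`. -/
lemma sum_mul_pd_inv {v : Fin 3 → Coord → ℝ} {s : ℝ} (hx : x ∈ U)
    (hL : ∀ a b, lieD v (fun a b y => g y a b) a b x = 2 * s * g x a b) (a b : Fin 3) :
    ∑ c, v c x * pd c (fun y => inv g y a b) x =
      (∑ i, inv g x a i * pd i (v b) x + ∑ j, inv g x j b * pd j (v a) x) -
        2 * s * inv g x a b := by
  have h₀ : ∑ c, v c x * pd c (fun y => inv g y a b) x = -∑ i, ∑ j,
      inv g x a i * inv g x j b * ∑ c, v c x * pd c (fun y => g y i j) x := by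
    simp only [hg.pd_inv hx, Fin.sum_univ_three]
    ring
  have h (i j : Fin 3) : ∑ c, v c x * pd c (fun y => g y i j) x = 2 * s * g x i j -
      ∑ c, g x c j * pd i (v c) x - ∑ c, g x i c * pd j (v c) x := by
    have := hL i j
    simp only [lieD, Finset.sum_add_distrib] at this
    linarith
  have h₁ : ∑ i, ∑ j, inv g x a i * inv g x j b * (2 * s * g x i j) = 2 * s * inv g x a b := by
    have (i j : Fin 3) : inv g x a i * inv g x j b * (2 * s * g x i j) =
      2 * s * inv g x a i * (g x i j * inv g x j b) := by ring
    simp only [this, ← Finset.mul_sum, hg.sum_mul_inv hx]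
    simp
  have h₂ : ∑ i, ∑ j, inv g x a i * inv g x j b * ∑ c, g x c j * pd i (v c) x =
      ∑ i, inv g x a i * pd i (v b) x := by
    refine Finset.sum_congr rfl fun i _ => ?_
    simp only [Finset.mul_sum]
    rw [Finset.sum_comm]
    have (c j : Fin 3) : inv g x a i * inv g x j b * (g x c j * pd i (v c) x) =
      inv g x a i * pd i (v c) x * (g x c j * inv g x j b) := by ring
    simp only [this, ← Finset.mul_sum, hg.sum_mul_inv hx]
    simp
  have h₃ : ∑ i, ∑ j, inv g x a i * inv g x j b * ∑ c, g x i c * pd j (v c) x =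
      ∑ j, inv g x j b * pd j (v a) x := by
    rw [Finset.sum_comm]
    refine Finset.sum_congr rfl fun j _ => ?_
    simp only [Finset.mul_sum]
    rw [Finset.sum_comm]
    have (c i : Fin 3) : inv g x a i * inv g x j b * (g x i c * pd j (v c) x) =
      inv g x j b * pd j (v c) x * (inv g x a i * g x i c) := by ring
    simp only [this, ← Finset.mul_sum, hg.sum_inv_mul hx]
    simp
  simp only [h₀, h, mul_sub, Finset.sum_sub_distrib, h₁, h₂, h₃]
  ring

/-- The trace of the Lie derivative of a covariant 2-tensor along a vector field `v` with
`𝓛_v g = 2 s g` at a point: `g^{ab} 𝓛_v T_{ab} = v(g^{ab} T_{ab}) + 2 s g^{ab} T_{ab}` there. -/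
lemma sum_inv_lieD {v : Fin 3 → Coord → ℝ} {T : Fin 3 → Fin 3 → Coord → ℝ} {s : ℝ}
    (hT : ∀ a b, ContDiffOn ℝ ∞ (T a b) U) (hx : x ∈ U)
    (hL : ∀ a b, lieD v (fun a b y => g y a b) a b x = 2 * s * g x a b) :
    ∑ a, ∑ b, inv g x a b * lieD v T a b x =
      ∑ c, v c x * pd c (fun y => ∑ a, ∑ b, inv g y a b * T a b y) x +
        2 * s * ∑ a, ∑ b, inv g x a b * T a b x := by
  have hT' (a b : Fin 3) := differentiableAt_of_contDiffOn hg.isOpen (hT a b) hx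
  have hi (a b : Fin 3) := differentiableAt_of_contDiffOn hg.isOpen (hg.contDiffOn_inv a b) hx
  have hpd (c : Fin 3) : pd c (fun y => ∑ a, ∑ b, inv g y a b * T a b y) x =
      ∑ a, ∑ b, (pd c (fun y => inv g y a b) x * T a b x + inv g x a b * pd c (T a b) x) := by
    rw [pd_sum (F := fun a y => ∑ b, inv g y a b * T a b y) _ _ fun a _ =>
      DifferentiableAt.fun_sum fun b _ => (hi a b).fun_mul (hT' a b)]
    exact Finset.sum_congr rfl fun a _ =>
      pd_sum_mul (F := fun b y => inv g y a b) c (hi a) (hT' a)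
  -- the terms of `𝓛_v T` and of `v(g^{ab}) T_{ab}` that involve `∂v` are the same
  have h₁ : ∑ a, ∑ b, T a b x * ∑ c, v c x * pd c (fun y => inv g y a b) x =
      ∑ a, ∑ b, T a b x * ((∑ i, inv g x a i * pd i (v b) x +
        ∑ j, inv g x j b * pd j (v a) x) - 2 * s * inv g x a b) := by
    simp only [hg.sum_mul_pd_inv hx hL]
  simp only [hpd]
  simp only [lieD, Fin.sum_univ_three] at h₁ ⊢
  linear_combination -h₁

/-- If `w` is conformal Killing and `𝓛_w l_{ab} + D_a D_b η = 0`, then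
`Δ η = -½ η r - ¼ w^b D_b r`. -/
theorem box₀_of_conformalKilling (hw : ∀ i, ContDiffOn ℝ ∞ (w i) U)
    (hK : ∀ a b, covD₁ g w a b x + covD₁ g w b a x = 2 * η x * g x a b) (hx : x ∈ U)
    (hL : ∀ a b, lieD (raise g w) (schouten g) a b x + hess g η a b x = 0) :
    box₀ g η x = -(1 / 2) * η x * scalar g x -
      (1 / 4) * ∑ b, raise g w b x * pd b (scalar g) x := by
  have hsc : ContDiffOn ℝ ∞ (scalar g) U := ContDiffOn.sum fun b _ => ContDiffOn.sum fun d _ =>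
    (hg.contDiffOn_inv b d).mul (hg.contDiffOn_ricci b d)
  have h := hg.sum_inv_lieD hg.contDiffOn_schouten hx
    fun a b => (hg.lieD_metric hw hx a b).trans (hK a b)
  have hpd (c : Fin 3) : pd c (fun y => ∑ a, ∑ b, inv g y a b * schouten g a b y) x =
      (1 / 4) * pd c (scalar g) x := by
    rw [pd_congr hg.isOpen hx c fun y hy => hg.sum_inv_schouten hy,
      pd_const_mul c _ (differentiableAt_of_contDiffOn hg.isOpen hsc hx)]
  simp only [hpd, hg.sum_inv_schouten hx, fun a b => eq_neg_of_add_eq_zero_left (hL a b),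
    mul_neg, Finset.sum_neg_distrib, mul_left_comm _ (1 / 4 : ℝ), ← Finset.mul_sum] at h
  rw [box₀]
  linarith

end Comp.IsMetricOn

/-! ### Bilinear forms with an orthogonal basis -/

section DiagonalForm

variable {E : Type*} [AddCommGroup E] [Module ℝ E] [TopologicalSpace E] {B : E →L[ℝ] E →L[ℝ] ℝ}
  {n : Type*} [Fintype n] [DecidableEq n] {b : Module.Basis n ℝ E} {d : n → ℝ}

lemma apply_comm_of_diagonal (hb : ∀ i j, B (b i) (b j) = Matrix.diagonal d i j) (v w : E) :
    B v w = B w v := by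
  rw [← b.sum_repr v, ← b.sum_repr w]
  simp only [map_sum, sum_apply, map_smul, smul_apply, hb, smul_eq_mul, Matrix.diagonal_apply]
  simp [mul_left_comm]

/-- The Gram matrix of a linearly independent family of full size is invertible. -/
lemma det_ne_zero_of_diagonal (hb : ∀ i j, B (b i) (b j) = Matrix.diagonal d i j)
    (hd : ∀ i, d i ≠ 0) {c : n → E} (hc : LinearIndependent ℝ c) :
    (Matrix.of fun i j => B (c i) (c j)).det ≠ 0 := by
  intro h
  obtain ⟨u, hu, hu'⟩ := Matrix.exists_mulVec_eq_zero_iff.mpr h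
  -- a null vector of the matrix gives a vector `z` orthogonal to every `c i`, hence to every vector
  set z : E := ∑ j, u j • c j with hz
  have hcz (i : n) : B (c i) z = 0 := by
    have := congrFun hu' i
    simp only [Matrix.mulVec, dotProduct, Matrix.of_apply, Pi.zero_apply] at this
    rw [hz, map_sum, ← this]
    exact Finset.sum_congr rfl fun j _ => by rw [map_smul, smul_eq_mul, mul_comm]
  have hspan : Submodule.span ℝ (Set.range c) = ⊤ := by
    have := Module.Finite.of_basis b
    exact hc.span_eq_top_of_card_eq_finrank' (Module.finrank_eq_card_basis b).symm
  have hBz (w : E) : B w z = 0 := by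
    have hw : w ∈ Submodule.span ℝ (Set.range c) := hspan ▸ Submodule.mem_top
    induction hw using Submodule.span_induction with
    | mem y hy => obtain ⟨i, rfl⟩ := hy; exact hcz i
    | zero => simp
    | add y y' _ _ hy hy' => simp [hy, hy']
    | smul t y _ hy => simp [hy]
  have hz₀ : z = 0 := b.ext_elem fun i => by
    have h := hBz (b i)
    rw [← b.sum_repr z] at h
    simp only [map_sum, map_smul, hb, smul_eq_mul, Matrix.diagonal_apply] at h
    simpa [hd] using h
  exact hu (funext (Fintype.linearIndependent_iff.mp hc u hz₀))

end DiagonalForm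

/-! ### Components in a chart -/

section Charts

open Bundle

variable {M : Type*} [TopologicalSpace M] [ChartedSpace Coord M]
  {e : OpenPartialHomeomorph M Coord}

/-- The differential of `e` sends the coordinate vectors to the standard basis. -/
lemma linearIndependent_coordVec (he : e ∈ IsManifold.maximalAtlas (𝓡 3) ∞ M) {x : Coord}
    (hx : x ∈ e.target) : LinearIndependent ℝ (fun i => coordVec e i x) := by
  have hs := (contMDiffOn_symm_of_mem_maximalAtlas he).contMDiffAt (e.open_target.mem_nhds hx)
  have ht := (contMDiffOn_of_mem_maximalAtlas he).contMDiffAt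
    (e.open_source.mem_nhds (e.map_target hx))
  have hcomp := mfderiv_comp x (ht.mdifferentiableAt (by simp)) (hs.mdifferentiableAt (by simp))
  have hid : mfderiv (𝓡 3) (𝓡 3) (e ∘ e.symm) x = ContinuousLinearMap.id ℝ _ := by
    rw [← mfderiv_id]
    refine Filter.EventuallyEq.mfderiv_eq ?_
    filter_upwards [e.open_target.mem_nhds hx] with y hy using e.right_inv hy
  rw [hid] at hcomp
  refine LinearIndependent.of_comp
    (mfderiv (𝓡 3) (𝓡 3) e (e.symm x) : TangentSpace (𝓡 3) (e.symm x) →ₗ[ℝ]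
      TangentSpace (𝓡 3) (e (e.symm x))) ?_
  have hfun : (fun i => (mfderiv (𝓡 3) (𝓡 3) e (e.symm x) (coordVec e i x) : Coord)) =
      (EuclideanSpace.basisFun (Fin 3) ℝ).toBasis := by
    funext i
    rw [OrthonormalBasis.coe_toBasis, EuclideanSpace.basisFun_apply]
    exact (congrArg (fun L : Coord →L[ℝ] Coord => L (EuclideanSpace.single i 1)) hcomp).symm
  change LinearIndependent ℝ (M := Coord)
    (fun i => (mfderiv (𝓡 3) (𝓡 3) e (e.symm x) (coordVec e i x) : Coord))
  rw [hfun]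
  exact (EuclideanSpace.basisFun (Fin 3) ℝ).toBasis.linearIndependent

variable [IsManifold (𝓡 3) ∞ M]

/-- The coordinate vector fields are smooth: `∂_i` is the tangent map of `e.symm` applied to the
constant section `e_i`. -/
lemma contMDiffOn_coordVec (he : e ∈ IsManifold.maximalAtlas (𝓡 3) ∞ M) (i : Fin 3) :
    ContMDiffOn (𝓡 3) ((𝓡 3).prod (𝓡 3)) ∞
      (fun x => TotalSpace.mk' Coord (E := fun p : M => TangentSpace (𝓡 3) p)
        (e.symm x) (coordVec e i x)) e.target := by
  have h := (contMDiffOn_symm_of_mem_maximalAtlas he).contMDiffOn_tangentMapWithin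
    (m := ∞) (by simp) e.open_target.uniqueMDiffOn
  have h' : ContMDiffOn (𝓡 3) ((𝓡 3).prod (𝓡 3)) ∞ (fun x : Coord =>
      (⟨x, EuclideanSpace.single i 1⟩ : TangentBundle (𝓡 3) Coord)) e.target := by
    intro x _
    refine contMDiffWithinAt_totalSpace.mpr ⟨contMDiffWithinAt_id, ?_⟩
    simpa using contMDiffWithinAt_const
  refine (h.comp h' fun x hx => hx).congr fun x hx => ?_
  simp only [Function.comp, tangentMapWithin, coordVec]
  rw [mfderivWithin_of_isOpen e.open_target hx]

lemma LorentzianMetric.contDiffOn_comp (ℓ : LorentzianMetric M)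
    (he : e ∈ IsManifold.maximalAtlas (𝓡 3) ∞ M) (i j : Fin 3) :
    ContDiffOn ℝ ∞ (fun x => ℓ.comp e x i j) e.target := by
  have h := ContMDiffOn.clm_bundle_apply₂ (F₁ := Coord) (F₂ := Coord) (F₃ := ℝ)
    (E₃ := Trivial M ℝ)
    (ℓ.contMDiff.comp_contMDiffOn (contMDiffOn_symm_of_mem_maximalAtlas he))
    (contMDiffOn_coordVec he i) (contMDiffOn_coordVec he j)
  intro x hx
  have hx := h x hx
  simp only [contMDiffWithinAt_totalSpace] at hx
  exact hx.2.contDiffWithinAt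

lemma CovectorField.contDiffOn_comp (ζ : CovectorField M)
    (he : e ∈ IsManifold.maximalAtlas (𝓡 3) ∞ M) (i : Fin 3) :
    ContDiffOn ℝ ∞ (ζ.comp e i) e.target := by
  have h := ContMDiffOn.clm_bundle_apply (F₁ := Coord) (F₂ := ℝ)
    (E₂ := Trivial M ℝ)
    (ζ.contMDiff.comp_contMDiffOn (contMDiffOn_symm_of_mem_maximalAtlas he))
    (contMDiffOn_coordVec he i)
  intro x hx
  have hx := h x hx
  simp only [contMDiffWithinAt_totalSpace] at hx
  exact hx.2.contDiffWithinAt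

lemma LorentzianMetric.isMetricOn_comp (ℓ : LorentzianMetric M)
    (he : e ∈ IsManifold.maximalAtlas (𝓡 3) ∞ M) : Comp.IsMetricOn e.target (ℓ.comp e) where
  isOpen := e.open_target
  contDiffOn := ℓ.contDiffOn_comp he
  symm {x} _ i j := by
    obtain ⟨b, hb⟩ := ℓ.lorentzian (e.symm x)
    exact apply_comm_of_diagonal hb _ _
  det_ne_zero {x} hx := by
    obtain ⟨b, hb⟩ := ℓ.lorentzian (e.symm x)
    refine det_ne_zero_of_diagonal hb (fun i => ?_) (linearIndependent_coordVec he hx)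
    fin_cases i <;> simp

end Charts

/-! ### The identities on the manifold -/

theorem mainTheorem6 {M : Type*} [TopologicalSpace M] [ChartedSpace Coord M]
    [IsManifold (𝓡 3) ∞ M] (ℓ : LorentzianMetric M) (ζ : CovectorField M)
    (η : M → ℝ) (hη : ContMDiff (𝓡 3) 𝓘(ℝ, ℝ) ∞ η)
    -- `D_a ζ_b + D_b ζ_a = 2 η ℓ_{ab}` in every chart
    (hKilling : ∀ e ∈ IsManifold.maximalAtlas (𝓡 3) ∞ M, ∀ x ∈ e.target, ∀ a b : Fin 3,
      Comp.covD₁ (ℓ.comp e) (ζ.comp e) a b x + Comp.covD₁ (ℓ.comp e) (ζ.comp e) b a x =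
        2 * η (e.symm x) * ℓ.comp e x a b)
    -- `𝓛_ζ l_{ab} + D_a D_b η = 0` in every chart
    (hLie : ∀ e ∈ IsManifold.maximalAtlas (𝓡 3) ∞ M, ∀ x ∈ e.target, ∀ a b : Fin 3,
      Comp.lieD (Comp.raise (ℓ.comp e) (ζ.comp e)) (Comp.schouten (ℓ.comp e)) a b x +
        Comp.hess (ℓ.comp e) (fun y => η (e.symm y)) a b x = 0) :
    ∀ e ∈ IsManifold.maximalAtlas (𝓡 3) ∞ M, ∀ x ∈ e.target,
      -- `Δ ζ_a = - r_a^b ζ_b - D_a η`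
      (∀ a : Fin 3, Comp.box₁ (ℓ.comp e) (ζ.comp e) a x =
        -(∑ b, Comp.ricci (ℓ.comp e) a b x * Comp.raise (ℓ.comp e) (ζ.comp e) b x) -
          Comp.pd a (fun y => η (e.symm y)) x) ∧
      -- `Δ η = - ½ η r - ¼ ζ^b D_b r`
      Comp.box₀ (ℓ.comp e) (fun y => η (e.symm y)) x =
        -(1 / 2) * η (e.symm x) * Comp.scalar (ℓ.comp e) x -
          (1 / 4) * ∑ b, Comp.raise (ℓ.comp e) (ζ.comp e) b x *
            Comp.pd b (Comp.scalar (ℓ.comp e)) x := by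
  intro e he x hx
  have hg := ℓ.isMetricOn_comp he
  have hw := ζ.contDiffOn_comp he
  have hη' : ContDiffOn ℝ ∞ (fun y => η (e.symm y)) e.target :=
    (hη.comp_contMDiffOn (contMDiffOn_symm_of_mem_maximalAtlas he)).contDiffOn
  exact ⟨hg.box₁_of_conformalKilling hw hη' (hKilling e he) hx,
    hg.box₀_of_conformalKilling hw (hKilling e he x hx) hx (hLie e he x hx)⟩
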